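/- **Theorem 4.5.** *Setting.* Let $L$ be the set of all well-formed formulas of a first-order language (variables $x_0,x_1,\dots$, at least one predicate letter, primitive connectives $\neg,\to,\forall$), written as nonempty words over a finite alphabet. For $A\subseteq L$ let $S(A)=\{\varphi\in L : A\vdash\varphi\}$, where $\vdash$ is derivability in the Hilbert-style predicate calculus with the schemes $\varphi\to(\psi\to\varphi)$; $(\varphi\to(\psi\to\chi))\to((\varphi\to\psi)\to(\varphi\to\chi))$; $(\neg\psi\to\neg\varphi)\to((\neg\psi\to\varphi)\to\psi)$; $\forall x\,\varphi\to\varphi(t)$ for $t$ free for $x$ in $\varphi$; $\forall x(\varphi\to\psi)\to(\varphi\to\forall x\,\psi)$ for $x$ not free in $\varphi$; and the rules modus ponens and generalization. A consequence operator on $L$ is a map $C:\mathcal P(L)\to\mathcal P(L)$ with $X\subseteq C(X)=C(C(X))$, and $C(X)\subseteq C(Y)$ whenever $X\subseteq Y$; it is finitary if $C(X)=\bigcup\{C(F): F\subseteq X \text{ finite}\}$. Write $C\le C'$ if $C(X)\subseteq C'(X)$ for all $X\subseteq L$. Call $T'=\{C_n : n\in\mathbb N\}$ an approximating chain for $S$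 if the $C_n$ are finitary consequence operators, any two of them are $\le$-comparable, for every $m$ there is $n$ with $C_m<C_n$, $S(X)=\bigcup_n C_n(X)$ for all $X\subseteq L$, and $C_n\ne S$ for all $n$. Let $\mathcal N$ be the superstructure with set of atoms $\mathbb N$. Fix an injection $i$ of the nonempty words into $\mathbb N$, and represent a word $w$ by the set of all finite sequences $(i(u_0),\dots,i(u_n))$ with $u_n\cdots u_0=w$; in this way $L$, its subsets, the operators on $\mathcal P(L)$ and $T'$ become elements of $\mathcal N$. Let ${}^*$ be an embedding of $\mathcal N$ into an enlargement ${}^*\mathcal N$: transfer holds for bounded formulas, and every relation in $\mathcal N$ that is concurrent on its domain is satisfied by one element of ${}^*\mathcal N$ simultaneously at all standard elements ${}^*x$ of its domain. Each $b\in L$ is identified with ${}^*b$, so that $L\subseteq{}^*L$. A subtle consequence operator on ${}^*L$ is an internal map $C$ from the internal subsets of ${}^*L$ to themselves with $X\subseteq C(X)=C(C(X))$, and $C(X)\subseteq C(Y)$ whenever $X\subseteq Y$; it is purely subtle if there is no $D\in\mathcal N$ with $C={}^*D$ or $C=\{{}^*d : d\in D\}$. For $A\subseteq L$ let $F(A)$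 be the set of finite subsets of $A$. *Claim.* There is an approximating chain for $S$ all of whose members are obtained from the calculus above by restricting modus ponens to a subset of its instances. Moreover, for every approximating chain $T'$ for $S$ and every $A\subseteq L$ there are a purely subtle $C_1\in{}^*T'$ and a $^*$-finite $F_1\in{}^*(F(A))$ such that for every $B\subseteq A$ and every $C\in T'$ (i) $C(B)\subseteq C_1(F_1)$; (ii) $S(B)\subseteq C_1(F_1)\subseteq {}^*S(F_1)\subseteq{}^*(S(A))$; (iii) ${}^*S(F_1)\cap L=S(A)=C_1(F_1)\cap L$. -/

import Mathlib

open FirstOrder Set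

universe u v w z

noncomputable section

namespace Nonstd

/-! ## The superstructure over the natural numbers

Elements are coded by ZFC sets: the atom `k` is a pair tagged by `∅`, a set with members `s` is the
pair of the tag `{∅}` and `s`.  So atoms have no members and differ from all sets. -/

/-- The code of the natural number `k` as an atom. -/
def atomCode (k : ℕ) : ZFSet.{0} := ZFSet.pair ∅ ((fun x : ZFSet.{0} => {x})^[k] ∅)

/-- The code of the set whose members are those of `s`. -/
def setCode (s : ZFSet.{0}) : ZFSet.{0} := ZFSet.pair {∅} s

/-- The levels of the superstructure: `V₀ = ℕ` and `Vₙ₊₁ = Vₙ ∪ 𝒫(Vₙ)`. -/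
def Level : ℕ → Set ZFSet.{0}
  | 0 => range atomCode
  | n + 1 => Level n ∪ {x | ∃ s : ZFSet.{0}, x = setCode s ∧ ∀ y ∈ s, y ∈ Level n}

/-- The superstructure over the set `ℕ` of atoms: the union of all levels. -/
def Super : Type 1 := {x : ZFSet.{0} // ∃ n, x ∈ Level n}

/-- Membership in the superstructure. -/
def Mem (x y : Super) : Prop := ∃ s : ZFSet.{0}, y.1 = setCode s ∧ x.1 ∈ s

/-- The natural number `k` as an atom of the superstructure. -/
def atom (k : ℕ) : Super := ⟨atomCode k, 0, k, rfl⟩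

/-- `y` is the element of the superstructure that is a set (not an atom) with `S` as its collection
of members. -/
def IsSetOf (y : Super) (S : Set Super) : Prop :=
  (∃ s : ZFSet.{0}, y.1 = setCode s) ∧ ∀ x, Mem x y ↔ x ∈ S

open Classical in
/-- The set with the members `S`.  It exists as soon as `S` lies in one level, see
`isSetOf_ofSet`; all the sets built below do. -/
def ofSet (S : Set Super) : Super :=
  if h : ∃ y, IsSetOf y S then h.choose else atom 0

theorem setCode_inj {s t : ZFSet.{0}} (h : setCode s = setCode t) : s = t :=
  (ZFSet.pair_inj.1 h).2

theorem exists_zfset_level (n : ℕ) : ∃ t : ZFSet.{0}, ∀ x, x ∈ t ↔ x ∈ Level n := by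
  induction n with
  | zero => exact ⟨ZFSet.range atomCode, fun x => by simp [Level]⟩
  | succ n ih =>
    obtain ⟨t, ht⟩ := ih
    refine ⟨t ∪ ZFSet.range (fun s : t.powerset => setCode s.1), fun x => ?_⟩
    simp only [ZFSet.mem_union, ZFSet.mem_range, Level, mem_union, ht, mem_ofPred_eq]
    refine or_congr Iff.rfl ⟨?_, ?_⟩
    · rintro ⟨⟨s, hs⟩, rfl⟩
      exact ⟨s, rfl, fun y hy => (ht y).1 (ZFSet.mem_powerset.1 hs hy)⟩
    · rintro ⟨s, rfl, hs⟩
      exact ⟨⟨s, ZFSet.mem_powerset.2 fun y hy => (ht y).2 (hs y hy)⟩, rfl⟩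

theorem isSetOf_ofSet {S : Set Super} {n : ℕ} (h : ∀ x ∈ S, x.1 ∈ Level n) :
    IsSetOf (ofSet S) S := by
  have hex : ∃ y, IsSetOf y S := by
    obtain ⟨t, ht⟩ := exists_zfset_level n
    set s : ZFSet.{0} := ZFSet.sep (fun x => ∃ y ∈ S, y.1 = x) t with hs
    have hmem : ∀ x, x ∈ s ↔ ∃ y ∈ S, y.1 = x := by
      intro x
      rw [hs, ZFSet.mem_sep, ht]
      exact ⟨fun hx => hx.2, fun ⟨y, hy, hyx⟩ => ⟨hyx ▸ h y hy, y, hy, hyx⟩⟩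
    refine ⟨⟨setCode s, n + 1, Or.inr ⟨s, rfl, fun y hy => ?_⟩⟩, ⟨s, rfl⟩, fun x => ?_⟩
    · obtain ⟨a, ha, rfl⟩ := (hmem y).1 hy
      exact h a ha
    · constructor
      · rintro ⟨s', h1, h2⟩
        rw [← setCode_inj h1, hmem] at h2
        obtain ⟨a, ha, hax⟩ := h2
        rwa [← Subtype.ext hax]
      · exact fun hx => ⟨s, rfl, (hmem _).2 ⟨x, hx, rfl⟩⟩
  rw [ofSet, dif_pos hex]
  exact hex.choose_spec

/-- The Kuratowski pair `{{a}, {a, b}}` in the superstructure. -/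
def pair (a b : Super) : Super := ofSet {ofSet {a}, ofSet {a, b}}

/-! ## Notions that make sense for any binary relation `E`, read as membership -/

section Rel

variable {X : Type z} (E : X → X → Prop)

/-- The collection of members of `a`. -/
def ext (a : X) : Set X := {x | E x a}

/-- `p` is the Kuratowski pair of `a` and `b`. -/
def IsPair (p a b : X) : Prop :=
  ∃ s t, E s p ∧ E t p ∧ (∀ r, E r p → r = s ∨ r = t) ∧
    (∀ x, E x s ↔ x = a) ∧ (∀ x, E x t ↔ x = a ∨ x = b)

/-- `(x, y) ∈ f`. -/
def App (f x y : X) : Prop := ∃ p, E p f ∧ IsPair E p x y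

/-- The collection of members of the value `f(x)`. -/
def val (f x : X) : Set X := {r | ∃ y, App E f x y ∧ E r y}

/-- Bounded first-order formulas of set theory, with variables indexed by `ℕ`;
`bex i j φ` is `∃ vᵢ ∈ vⱼ, φ`. -/
inductive BForm : Type
  | eq (i j : ℕ) : BForm
  | mem (i j : ℕ) : BForm
  | neg (φ : BForm) : BForm
  | and (φ ψ : BForm) : BForm
  | bex (i j : ℕ) (φ : BForm) : BForm

/-- Truth of a bounded formula in `(X, E, =)` under an assignment. -/
def BForm.Holds : BForm → (ℕ → X) → Prop
  | .eq i j, a => a i = a j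
  | .mem i j, a => E (a i) (a j)
  | .neg φ, a => ¬ φ.Holds a
  | .and φ ψ, a => φ.Holds a ∧ ψ.Holds a
  | .bex i j φ, a => ∃ x, E x (a j) ∧ φ.Holds (Function.update a i x)

end Rel

/-- `(H, E, =)` with `star : Super → H` is an enlargement of the superstructure over `ℕ`:
transfer holds for all bounded formulas (in particular, this is so if `star` is an elementary
embedding), and each relation of the superstructure that is concurrent on its domain is satisfied
for the images of all elements of the domain at once. -/
structure IsEnlargement {H : Type z} (E : H → H → Prop) (star : Super → H) : Prop where
  transfer : ∀ (φ : BForm) (a : ℕ → Super), φ.Holds Mem a ↔ φ.Holds E (star ∘ a)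
  saturated : ∀ R : Super,
    (∀ F : Set Super, F.Finite → (∀ x ∈ F, ∃ y, App Mem R x y) → ∃ y, ∀ x ∈ F, App Mem R x y) →
    ∃ b : H, ∀ x : Super, (∃ y, App Mem R x y) → App E (star R) (star x) b

/-! ## Subtle consequence operators -/

/-- `C` is (internally) a map from the family `P` of internal sets to itself and satisfies the axioms
`X ⊆ C(X) = C(C(X))` and `X ⊆ Y → C(X) ⊆ C(Y)` there.  An operator that satisfies the first axiom
and the finiteness axiom, or the transforms of these, satisfies the second one as well. -/
structure IsSubtle {H : Type z} (E : H → H → Prop) (P C : H) : Prop where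
  graph : ∀ p, E p C → ∃ x y, E x P ∧ E y P ∧ IsPair E p x y
  func : ∀ x, E x P → ∃! y, App E C x y
  extensive : ∀ x y, App E C x y → ext E x ⊆ ext E y
  idempotent : ∀ x y, App E C x y → App E C y y
  monotone : ∀ x y x' y', App E C x y → App E C x' y' → ext E x ⊆ ext E x' → ext E y ⊆ ext E y'

/-- A subtle operator is purely subtle if there is no standard `D` with `C = *D` or
`C = {*d | d ∈ D}`. -/
def IsPurelySubtle {H : Type z} (E : H → H → Prop) (star : Super → H) (P C : H) : Prop :=
  IsSubtle E P C ∧ ¬ ∃ D : Super, C = star D ∨ ext E C = star '' ext Mem D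

/-! ## Predicate calculus -/

/-- Well-formed formulas over a first-order signature, with variables indexed by `ℕ` and the
primitive connectives `¬`, `→`, `∀`. -/
inductive Fml (L : FirstOrder.Language.{u, v}) : Type (max u v)
  | rel {k : ℕ} (R : L.Relations k) (ts : Fin k → L.Term ℕ) : Fml L
  | neg (φ : Fml L) : Fml L
  | imp (φ ψ : Fml L) : Fml L
  | all (x : ℕ) (φ : Fml L) : Fml L

variable {L : FirstOrder.Language.{u, v}}

/-- The variable `x` has a free occurrence. -/
def Fml.Free (x : ℕ) : Fml L → Prop
  | .rel _ ts => ∃ j, x ∈ (ts j).varFinset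
  | .neg φ => φ.Free x
  | .imp φ ψ => φ.Free x ∨ ψ.Free x
  | .all y φ => x ≠ y ∧ φ.Free x

/-- Replace the free occurrences of `x` by the term `t`. -/
def Fml.subst (x : ℕ) (t : L.Term ℕ) : Fml L → Fml L
  | .rel R ts => .rel R fun j => (ts j).subst fun y => if y = x then t else .var y
  | .neg φ => .neg (φ.subst x t)
  | .imp φ ψ => .imp (φ.subst x t) (ψ.subst x t)
  | .all y φ => if y = x then .all y φ else .all y (φ.subst x t)

/-- `t` is free for `x`: no free occurrence of `x` is in the scope of a quantifier that binds a
variable of `t`. -/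
def Fml.FreeFor (x : ℕ) (t : L.Term ℕ) : Fml L → Prop
  | .rel _ _ => True
  | .neg φ => φ.FreeFor x t
  | .imp φ ψ => φ.FreeFor x t ∧ ψ.FreeFor x t
  | .all y φ => ¬ (Fml.all y φ).Free x ∨ (y ∉ t.varFinset ∧ φ.FreeFor x t)

/-- The logical schemes of the predicate calculus. -/
inductive Logical : Fml L → Prop
  | k (φ ψ : Fml L) : Logical (.imp φ (.imp ψ φ))
  | s (φ ψ χ : Fml L) :
      Logical (.imp (.imp φ (.imp ψ χ)) (.imp (.imp φ ψ) (.imp φ χ)))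
  | contra (φ ψ : Fml L) :
      Logical (.imp (.imp (.neg ψ) (.neg φ)) (.imp (.imp (.neg ψ) φ) ψ))
  | inst (x : ℕ) (t : L.Term ℕ) (φ : Fml L) (h : φ.FreeFor x t) :
      Logical (.imp (.all x φ) (φ.subst x t))
  | dist (x : ℕ) (φ ψ : Fml L) (h : ¬ φ.Free x) :
      Logical (.imp (.all x (.imp φ ψ)) (.imp φ (.all x ψ)))

/-- Derivability from the premises `A` by generalization and by those instances
"from `φ` and `φ → ψ` infer `ψ`" of modus ponens for which `(φ, ψ) ∈ R`. -/
inductive Derives (R : Set (Fml L × Fml L)) (A : Set (Fml L)) : Fml L → Prop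
  | hyp {φ : Fml L} (h : φ ∈ A) : Derives R A φ
  | logical {φ : Fml L} (h : Logical φ) : Derives R A φ
  | mp {φ ψ : Fml L} (hR : (φ, ψ) ∈ R) (h₁ : Derives R A φ) (h₂ : Derives R A (.imp φ ψ)) :
      Derives R A ψ
  | gen {φ : Fml L} (x : ℕ) (h : Derives R A φ) : Derives R A (.all x φ)

theorem Derives.trans {R : Set (Fml L × Fml L)} {A B : Set (Fml L)} {φ : Fml L}
    (h : Derives R A φ) (hB : ∀ ψ ∈ A, Derives R B ψ) : Derives R B φ := by
  induction h with
  | hyp h => exact hB _ h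
  | logical h => exact .logical h
  | mp hR _ _ ih₁ ih₂ => exact .mp hR ih₁ ih₂
  | gen x _ ih => exact .gen x ih

/-- The consequence operator of the predicate calculus with modus ponens restricted to `R`. -/
def restrictedOp (R : Set (Fml L × Fml L)) : ClosureOperator (Set (Fml L)) where
  toFun A := {φ | Derives R A φ}
  monotone' _ _ h _ hφ := Derives.trans hφ fun _ hψ => .hyp (h hψ)
  le_closure' _ _ h := .hyp h
  idempotent' _ := Subset.antisymm (fun _ h => Derives.trans h fun _ hψ => hψ) fun _ h => .hyp h

/-- The predicate consequence operator. -/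
def predicateOp (L : FirstOrder.Language.{u, v}) : ClosureOperator (Set (Fml L)) :=
  restrictedOp univ

/-- `{C n | n ∈ ℕ}` is a chain without last element of finitary consequence operators different from
the predicate consequence operator, which is their union.  Operators are ordered pointwise. -/
structure IsApproximation (C : ℕ → ClosureOperator (Set (Fml L))) : Prop where
  finitary : ∀ n X, C n X = ⋃ F ∈ {F : Set (Fml L) | F.Finite ∧ F ⊆ X}, C n F
  chain : ∀ m n, ⇑(C m) ≤ ⇑(C n) ∨ ⇑(C n) ≤ ⇑(C m)
  strict : ∀ m, ∃ n, ⇑(C m) < ⇑(C n)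
  union : ∀ X, predicateOp L X = ⋃ n, C n X
  ne_predicateOp : ∀ n, C n ≠ predicateOp L

/-! ## Embedding a formal language into the superstructure -/

/-- Nonempty words over an alphabet. -/
def Word (𝒜 : Type w) : Type w := {l : List 𝒜 // l ≠ []}

/-- For an injection `i` of the words into `ℕ`, a sequence `u 0, …, u n` of words is represented by
the function `k ↦ i (u k)` on `{0, …, n}`, and stands for the word `(u n) ⋯ (u 0)`.  The word `q` is
represented by the class of all the sequences that stand for `q`. -/
def readable {𝒜 : Type w} (i : Word 𝒜 → ℕ) (q : Word 𝒜) : Super :=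
  ofSet {f | ∃ (n : ℕ) (u : Fin (n + 1) → Word 𝒜),
    (((List.ofFn u).reverse.map Subtype.val).flatten = q.1) ∧
    f = ofSet (range fun k : Fin (n + 1) => pair (atom k) (atom (i (u k))))}

section Bold

variable (code : Fml L → Super)

/-- The element of the superstructure that corresponds to a set of formulas. -/
def boldSet (X : Set (Fml L)) : Super := ofSet (code '' X)

/-- The set of all subsets of the language. -/
def boldPower : Super := ofSet (range (boldSet code))

/-- The set of all finite subsets of `X`. -/
def boldFin (X : Set (Fml L)) : Super := ofSet (boldSet code '' {F | F.Finite ∧ F ⊆ X})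

/-- The element of the superstructure that corresponds to a consequence operator. -/
def boldOp (C : ClosureOperator (Set (Fml L))) : Super :=
  ofSet (range fun X => pair (boldSet code X) (boldSet code (C X)))

/-- The element of the superstructure that corresponds to a sequence of consequence operators. -/
def boldChain (C : ℕ → ClosureOperator (Set (Fml L))) : Super :=
  ofSet (range fun n => boldOp code (C n))

end Bold

end Nonstd

end

namespace Nonstd

/-! ## Sets and pairs in the superstructure -/

/-! The chain of calculi: let `α` be atomic, and let the `n`-th calculus forbid modus ponens with
conclusion `¬ᵐα`, `m ≥ n`. The logical schemes are implications and generalization yields `∀`, so a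
negation can only be a premise or come from modus ponens. Hence the `n`-th calculus cannot detach
`¬ⁿ⁺¹α` and is weaker than `S`. Each instance is allowed from some `n` on, and a derivation uses
finitely many, so the union is `S` (`isApproximation_restrictedOp`).

The nonstandard part uses concurrency twice. The order on the chain gives `C₁ ∈ *T'` above every
`*Cₙ` (`exists_isPurelySubtle`); inclusion of finite subsets of `A` gives `F₁ ∈ *(F(A))` that
includes `*G` for every finite `G ⊆ A` (`exists_boldFin`). If `φ ∈ Cₙ(B)`, finitarity gives a finite
`G ⊆ B` with `φ ∈ Cₙ(G)`, so `*φ ∈ *Cₙ(*G) ⊆ C₁(*G) ⊆ C₁(F₁)`. From above, transfer gives `C₁(F₁) ⊆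
*S(F₁) ⊆ *S(*A) = *(S(A))`, whose standard formulas are those of `S(A)`.

`C₁` is purely subtle: were it `*D`, then `D` would be a largest `Cₙ`, but the chain has none; were
all its pairs standard, so would be all its arguments, but an infinite set has nonstandard elements
in its extension. -/

theorem level_mono {m n : ℕ} (h : m ≤ n) : Level m ⊆ Level n := by
  induction h with
  | refl => exact subset_rfl
  | step _ ih => exact ih.trans subset_union_left

theorem zfset_singleton_ne_empty (x : ZFSet.{0}) : ({x} : ZFSet.{0}) ≠ ∅ := fun h =>
  ZFSet.notMem_empty x (h ▸ ZFSet.mem_singleton.2 rfl)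

/-- The tags `∅` and `{∅}` differ, so the code of a set enters the hierarchy only at a successor
level, after its members. Thus members of a code are again elements of `Super`. -/
theorem exists_level_of_mem {x : Super} {s a : ZFSet.{0}} (hs : x.1 = setCode s) (ha : a ∈ s) :
    ∃ n, a ∈ Level n := by
  obtain ⟨n, hn⟩ := x.2
  rw [hs] at hn
  clear hs
  induction n with
  | zero =>
    obtain ⟨k, hk⟩ := hn
    exact absurd (ZFSet.pair_inj.1 hk).1.symm (zfset_singleton_ne_empty ∅)
  | succ n ih =>
    rcases hn with hn | ⟨s', hs', hl⟩
    · exact ih hn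
    · exact ⟨n, hl a (setCode_inj hs' ▸ ha)⟩

/-- The members of `S` all lie in level `n`. -/
def Within (n : ℕ) (S : Set Super) : Prop := ∀ x ∈ S, x.1 ∈ Level n

theorem Within.mem_ofSet {n : ℕ} {S : Set Super} (h : Within n S) {x : Super} :
    Mem x (ofSet S) ↔ x ∈ S :=
  (isSetOf_ofSet h).2 x

/-- The level bounds matter: `ofSet` has the default value `atom 0` on collections that are not sets
of the superstructure. -/
theorem Within.ofSet_inj {m n : ℕ} {S T : Set Super} (hS : Within m S) (hT : Within n T)
    (h : ofSet S = ofSet T) : S = T := by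
  ext x
  rw [← hS.mem_ofSet, ← hT.mem_ofSet, h]

theorem Within.ofSet_level {n : ℕ} {S : Set Super} (h : Within n S) :
    (ofSet S).1 ∈ Level (n + 1) := by
  obtain ⟨⟨s, hs⟩, hmem⟩ := isSetOf_ofSet h
  refine .inr ⟨s, hs, fun a ha => ?_⟩
  exact h ⟨a, exists_level_of_mem hs ha⟩ ((hmem _).1 ⟨s, hs, ha⟩)

theorem within_singleton {n : ℕ} {a : Super} (ha : a.1 ∈ Level n) : Within n {a} := by
  rintro x rfl
  exact ha

theorem within_pair {n : ℕ} {a b : Super} (ha : a.1 ∈ Level n) (hb : b.1 ∈ Level n) :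
    Within n {a, b} := by
  rintro x (rfl | rfl)
  exacts [ha, hb]

theorem pair_level {n : ℕ} {a b : Super} (ha : a.1 ∈ Level n) (hb : b.1 ∈ Level n) :
    (pair a b).1 ∈ Level (n + 2) :=
  (within_pair (within_singleton ha).ofSet_level (within_pair ha hb).ofSet_level).ofSet_level

theorem isPair_pair (a b : Super) : IsPair Mem (pair a b) a b := by
  obtain ⟨m, hm⟩ := a.2
  obtain ⟨n, hn⟩ := b.2
  have ha := level_mono (le_max_left m n) hm
  have hb := level_mono (le_max_right m n) hn
  have h := within_pair (within_singleton ha).ofSet_level (within_pair ha hb).ofSet_level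
  refine ⟨ofSet {a}, ofSet {a, b}, h.mem_ofSet.2 (.inl rfl), h.mem_ofSet.2 (.inr rfl),
    fun r hr => h.mem_ofSet.1 hr, fun x => (within_singleton ha).mem_ofSet,
    fun x => (within_pair ha hb).mem_ofSet⟩

/-- Only memberships are compared and `E` need not be extensional, so this also applies in the
enlargement. -/
theorem IsPair.unique {X : Type z} {E : X → X → Prop} {p a b a' b' : X}
    (h : IsPair E p a b) (h' : IsPair E p a' b') : a = a' ∧ b = b' := by
  obtain ⟨s, t, hs, ht, hst, hsx, htx⟩ := h
  obtain ⟨s', t', hs', ht', hst', hsx', htx'⟩ := h'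
  have e1 : a = a' := by
    rcases hst' s hs with rfl | rfl
    · exact (hsx' a).1 ((hsx a).2 rfl)
    · exact ((hsx a').1 ((htx' a').2 (.inl rfl))).symm
  subst e1
  refine ⟨rfl, ?_⟩
  have h1 : ∀ x, x = a ∨ x = b → x = a ∨ x = b' := fun x hx => by
    rcases hst' t ht with rfl | rfl
    · exact .inl ((hsx' x).1 ((htx x).2 hx))
    · exact (htx' x).1 ((htx x).2 hx)
  have h2 : ∀ x, x = a ∨ x = b' → x = a ∨ x = b := fun x hx => by
    rcases hst t' ht' with rfl | rfl
    · exact .inl ((hsx x).1 ((htx' x).2 hx))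
    · exact (htx x).1 ((htx' x).2 hx)
  rcases h1 b (.inr rfl) with h | h
  · rcases h2 b' (.inr rfl) with h' | h'
    · rw [h, h']
    · exact h'.symm
  · exact h

theorem pair_inj {a b a' b' : Super} (h : pair a b = pair a' b') : a = a' ∧ b = b' :=
  (isPair_pair a b).unique (h ▸ isPair_pair a' b')

theorem atom_injective : Function.Injective atom := by
  intro m n h
  have h1 : (fun x : ZFSet.{0} => {x})^[m] ∅ = (fun x : ZFSet.{0} => {x})^[n] ∅ :=
    (ZFSet.pair_inj.1 (congrArg Subtype.val h)).2
  clear h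
  have hne : ∀ k, (fun x : ZFSet.{0} => ({x} : ZFSet.{0}))^[k + 1] ∅ ≠ ∅ := fun k => by
    rw [Function.iterate_succ_apply']
    exact zfset_singleton_ne_empty _
  induction m generalizing n with
  | zero =>
    cases n with
    | zero => rfl
    | succ n => exact absurd h1.symm (hne n)
  | succ m ih =>
    cases n with
    | zero => exact absurd h1 (hne m)
    | succ n =>
      rw [Function.iterate_succ_apply', Function.iterate_succ_apply'] at h1
      rw [ih (ZFSet.singleton_injective h1)]

theorem atom_level (k : ℕ) : (atom k).1 ∈ Level 0 := ⟨k, rfl⟩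

/-- Members of relations that are given as sets of pairs. -/
theorem app_ofSet_range {ι : Sort*} {n : ℕ} {f g : ι → Super} (hf : ∀ k, (f k).1 ∈ Level n)
    (hg : ∀ k, (g k).1 ∈ Level n) {x y : Super} :
    App Mem (ofSet (range fun k => pair (f k) (g k))) x y ↔ ∃ k, x = f k ∧ y = g k := by
  have h : Within (n + 2) (range fun k => pair (f k) (g k)) := by
    rintro _ ⟨k, rfl⟩
    exact pair_level (hf k) (hg k)
  constructor
  · rintro ⟨p, hp, hpair⟩
    obtain ⟨k, rfl⟩ := h.mem_ofSet.1 hp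
    exact ⟨k, hpair.unique (isPair_pair _ _)⟩
  · rintro ⟨k, rfl, rfl⟩
    exact ⟨_, h.mem_ofSet.2 ⟨k, rfl⟩, isPair_pair _ _⟩

/-! ## The representation of words -/

section Readable

variable {𝒜 : Type w} (i : Word 𝒜 → ℕ)

theorem within_sequence {n : ℕ} (u : Fin (n + 1) → Word 𝒜) :
    Within 2 (range fun k : Fin (n + 1) => pair (atom k) (atom (i (u k)))) := by
  rintro _ ⟨k, rfl⟩
  exact pair_level (atom_level _) (atom_level _)

theorem within_readable (q : Word 𝒜) :
    Within 3 {f | ∃ (n : ℕ) (u : Fin (n + 1) → Word 𝒜),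
      (((List.ofFn u).reverse.map Subtype.val).flatten = q.1) ∧
      f = ofSet (range fun k : Fin (n + 1) => pair (atom k) (atom (i (u k))))} := by
  rintro _ ⟨n, u, -, rfl⟩
  exact (within_sequence i u).ofSet_level

theorem readable_level (q : Word 𝒜) : (readable i q).1 ∈ Level 4 :=
  (within_readable i q).ofSet_level

/-- The one-term sequence `(i q)` lies in the class of `q`, hence in that of `q'`. Comparing pairs
shows that a sequence equal to it has the single term `q`, and it stands for `q'`. -/
theorem readable_injective {i : Word 𝒜 → ℕ} (hi : Function.Injective i) :
    Function.Injective (readable i) := by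
  intro q q' h
  have hset := (within_readable i q).ofSet_inj (within_readable i q') h
  have hmem : ofSet (range fun k : Fin (0 + 1) => pair (atom k) (atom (i q))) ∈
      {f | ∃ (n : ℕ) (u : Fin (n + 1) → Word 𝒜),
        (((List.ofFn u).reverse.map Subtype.val).flatten = q.1) ∧
        f = ofSet (range fun k : Fin (n + 1) => pair (atom k) (atom (i (u k))))} :=
    ⟨0, fun _ => q, by
      rw [List.ofFn_succ, List.ofFn_zero]
      exact List.append_nil _, rfl⟩
  rw [hset] at hmem
  obtain ⟨n, u, hu, hf⟩ := hmem
  have hr := (within_sequence i fun _ : Fin (0 + 1) => q).ofSet_inj (within_sequence i u) hf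
  have hk : ∀ k, k = 0 ∧ u k = q := by
    intro k
    have : pair (atom k) (atom (i (u k))) ∈
        range fun k : Fin (0 + 1) => pair (atom k) (atom (i q)) := by
      rw [hr]
      exact ⟨k, rfl⟩
    obtain ⟨j, hj⟩ := this
    obtain ⟨h1, h2⟩ := pair_inj hj
    refine ⟨?_, (hi (atom_injective h2)).symm⟩
    have := atom_injective h1
    ext
    simp only [Fin.val_zero]
    omega
  have hn : n = 0 := by
    have := congrArg Fin.val (hk (Fin.last n)).1
    simpa using this
  subst hn
  apply Subtype.ext
  rw [← hu, List.ofFn_succ, List.ofFn_zero, (hk 0).2]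
  exact (List.append_nil _).symm

end Readable

/-! ## Restricting modus ponens -/

section Calculus

variable {L : FirstOrder.Language.{u, v}}

theorem Derives.mono {R R' : Set (Fml L × Fml L)} {A A' : Set (Fml L)} {φ : Fml L}
    (h : Derives R A φ) (hR : R ⊆ R') (hA : A ⊆ A') : Derives R' A' φ := by
  induction h with
  | hyp h => exact .hyp (hA h)
  | logical h => exact .logical h
  | mp h _ _ ih₁ ih₂ => exact .mp (hR h) ih₁ ih₂
  | gen x _ ih => exact .gen x ih

theorem Derives.exists_finite {R : Set (Fml L × Fml L)} {A : Set (Fml L)} {φ : Fml L}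
    (h : Derives R A φ) : ∃ F : Set (Fml L), F.Finite ∧ F ⊆ A ∧ Derives R F φ := by
  induction h with
  | hyp h => exact ⟨_, finite_singleton _, singleton_subset_iff.2 h, .hyp rfl⟩
  | logical h => exact ⟨∅, finite_empty, empty_subset _, .logical h⟩
  | mp hR _ _ ih₁ ih₂ =>
    obtain ⟨F, hF, hFA, h₁⟩ := ih₁
    obtain ⟨G, hG, hGA, h₂⟩ := ih₂
    exact ⟨F ∪ G, hF.union hG, union_subset hFA hGA, .mp hR
      (h₁.mono subset_rfl subset_union_left) (h₂.mono subset_rfl subset_union_right)⟩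
  | gen x _ ih =>
    obtain ⟨F, hF, hFA, h⟩ := ih
    exact ⟨F, hF, hFA, .gen x h⟩

/-- A derivation uses finitely many instances of modus ponens, and by monotonicity a single index
allows them all. -/
theorem Derives.exists_index {R : ℕ → Set (Fml L × Fml L)} (hR : Monotone R)
    {A : Set (Fml L)} {φ : Fml L} (h : Derives (⋃ n, R n) A φ) : ∃ n, Derives (R n) A φ := by
  induction h with
  | hyp h => exact ⟨0, .hyp h⟩
  | logical h => exact ⟨0, .logical h⟩
  | mp h _ _ ih₁ ih₂ =>
    obtain ⟨k, hk⟩ := mem_iUnion.1 h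
    obtain ⟨m, hm⟩ := ih₁
    obtain ⟨n, hn⟩ := ih₂
    have h₁ := le_max_left k (max m n)
    have h₂ := (le_max_left m n).trans (le_max_right k (max m n))
    have h₃ := (le_max_right m n).trans (le_max_right k (max m n))
    exact ⟨max k (max m n), .mp (hR h₁ hk) (hm.mono (hR h₂) subset_rfl)
      (hn.mono (hR h₃) subset_rfl)⟩
  | gen x _ ih =>
    obtain ⟨n, hn⟩ := ih
    exact ⟨n, .gen x hn⟩

theorem restrictedOp_mono {R R' : Set (Fml L × Fml L)} (h : R ⊆ R') :
    ⇑(restrictedOp R) ≤ ⇑(restrictedOp R') :=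
  fun _ _ hφ => Derives.mono hφ h subset_rfl

/-- An increasing sequence of restrictions of modus ponens gives an approximation as soon as each
instance is allowed from some index on, and no member is the full operator. -/
theorem isApproximation_restrictedOp {R : ℕ → Set (Fml L × Fml L)} (hR : Monotone R)
    (hU : ⋃ n, R n = univ) (hne : ∀ n, restrictedOp (R n) ≠ predicateOp L) :
    IsApproximation fun n => restrictedOp (R n) := by
  have union : ∀ X, predicateOp L X = ⋃ n, restrictedOp (R n) X := by
    intro X
    refine Subset.antisymm (fun φ hφ => ?_)
      (iUnion_subset fun n => restrictedOp_mono (subset_univ _) X)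
    have hφ' : Derives (⋃ n, R n) X φ := hU ▸ hφ
    exact mem_iUnion.2 (hφ'.exists_index hR)
  refine ⟨fun n X => ?_, fun m n => ?_, fun m => ?_, union, hne⟩
  · refine Subset.antisymm (fun φ hφ => ?_)
      (iUnion₂_subset fun F hF => (restrictedOp (R n)).monotone hF.2)
    obtain ⟨F, hF, hFX, h⟩ := Derives.exists_finite hφ
    exact mem_iUnion₂.2 ⟨F, ⟨hF, hFX⟩, h⟩
  · exact (le_total m n).imp (fun h => restrictedOp_mono (hR h)) fun h => restrictedOp_mono (hR h)
  -- If nothing in the chain were strictly above the `m`-th operator, that operator would include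
  -- all others, hence their union `S`.
  · by_contra! hm
    refine hne m (ClosureOperator.ext _ _ fun X => ?_)
    refine Subset.antisymm (restrictedOp_mono (subset_univ _) X) ?_
    rw [union]
    refine iUnion_subset fun n => ?_
    rcases le_total n m with h | h
    · exact restrictedOp_mono (hR h) X
    · by_contra hX
      exact hm n ⟨restrictedOp_mono (hR h), fun h' => hX (h' X)⟩

theorem neg_iterate_injective {α : Fml L} (hα : ∀ β, α ≠ .neg β) :
    Function.Injective fun n => Fml.neg^[n] α := by
  intro m
  induction m with
  | zero =>
    intro n h
    cases n with
    | zero => rfl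
    | succ n => exact absurd (by simpa [Function.iterate_succ_apply'] using h) (hα _)
  | succ m ih =>
    intro n h
    cases n with
    | zero => exact absurd (by simpa [Function.iterate_succ_apply'] using h.symm) (hα _)
    | succ n =>
      simp only [Function.iterate_succ_apply', Fml.neg.injEq] at h
      rw [ih h]

theorem infinite_fml (hL : ∃ k, Nonempty (L.Relations k)) : Infinite (Fml L) := by
  obtain ⟨k, ⟨r⟩⟩ := hL
  exact Infinite.of_injective _
    (neg_iterate_injective (α := .rel r fun _ => .var 0) fun _ h => by cases h)

/-- No logical scheme and no generalization produces a formula that begins with `¬`. -/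
theorem not_derives_neg {R : Set (Fml L × Fml L)} {A : Set (Fml L)} {φ : Fml L}
    (hA : φ.neg ∉ A) (hR : ∀ ψ, (ψ, φ.neg) ∉ R) : ¬ Derives R A φ.neg := by
  intro h
  cases h with
  | hyp h => exact hA h
  | logical h => cases h
  | mp h => exact hR _ h

theorem exists_isApproximation_restrictedOp (hL : ∃ k, Nonempty (L.Relations k)) :
    ∃ R : ℕ → Set (Fml L × Fml L), IsApproximation fun n => restrictedOp (R n) := by
  obtain ⟨k, ⟨r⟩⟩ := hL
  let α : Fml L := .rel r fun _ => .var 0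
  have hinj : Function.Injective fun n => Fml.neg^[n] α :=
    neg_iterate_injective fun _ => by simp [α]
  refine ⟨fun n => {p | ∀ m ≥ n, p.2 ≠ Fml.neg^[m] α},
    isApproximation_restrictedOp (fun m n h p hp k hk => hp k (h.trans hk)) ?_ fun n h => ?_⟩
  · refine eq_univ_of_forall fun p => mem_iUnion.2 ?_
    by_cases hp : ∃ m, p.2 = Fml.neg^[m] α
    · obtain ⟨m, hm⟩ := hp
      exact ⟨m + 1, fun k hk e => by have := hinj (hm.symm.trans e); omega⟩
    · exact ⟨0, fun k _ e => hp ⟨k, e⟩⟩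
  -- The formula `¬ⁿ⁺¹α` follows from `φ` and `φ → ψ` by one forbidden step; both premises are
  -- implications, so neither is `ψ`.
  · let ψ : Fml L := Fml.neg (Fml.neg^[n] α)
    let φ : Fml L := .imp α α
    have h₁ : ψ ∈ predicateOp L {φ, .imp φ ψ} :=
      Derives.mp (φ := φ) (mem_univ _) (.hyp (.inl rfl)) (.hyp (.inr rfl))
    rw [← h] at h₁
    refine not_derives_neg ?_ ?_ h₁
    · simp [ψ, φ]
    · intro χ hχ
      exact hχ (n + 1) (Nat.le_succ n) (Function.iterate_succ_apply' _ _ _).symm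

end Calculus

/-! ## Bounded formulas -/

namespace BForm

/-- The implication `φ → ψ`. -/
def imp (φ ψ : BForm) : BForm := .neg (.and φ (.neg ψ))

/-- The disjunction `φ ∨ ψ`. -/
def or (φ ψ : BForm) : BForm := .neg (.and (.neg φ) (.neg ψ))

/-- The bounded universal quantifier `∀ vᵢ ∈ vⱼ, φ`. -/
def ball (i j : ℕ) (φ : BForm) : BForm := .neg (.bex i j (.neg φ))

/-- `vᵢ ⊆ vⱼ`; uses the variable `102`. -/
def sub (i j : ℕ) : BForm := ball 102 i (.mem 102 j)

/-- `v_p` is the pair of `v_a` and `v_b`; uses the variables `100`, `101`, `102`. -/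
def isPair (p a b : ℕ) : BForm :=
  .bex 100 p (.bex 101 p (.and (ball 102 p (or (.eq 102 100) (.eq 102 101)))
    (.and (.and (.mem a 100) (ball 102 100 (.eq 102 a)))
      (.and (.mem a 101) (.and (.mem b 101) (ball 102 101 (or (.eq 102 a) (.eq 102 b))))))))

/-- `(v_x, v_y) ∈ v_f`; uses the variables from `99` to `102`. -/
def app (f x y : ℕ) : BForm := .bex 99 f (isPair 99 x y)

variable {X : Type z} {E : X → X → Prop} {a : ℕ → X}

theorem holds_eq {i j : ℕ} : (BForm.eq i j).Holds E a ↔ a i = a j := Iff.rfl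

theorem holds_mem {i j : ℕ} : (BForm.mem i j).Holds E a ↔ E (a i) (a j) := Iff.rfl

theorem holds_and {φ ψ : BForm} : (φ.and ψ).Holds E a ↔ φ.Holds E a ∧ ψ.Holds E a := Iff.rfl

theorem holds_bex {i j : ℕ} {φ : BForm} :
    (bex i j φ).Holds E a ↔ ∃ x, E x (a j) ∧ φ.Holds E (Function.update a i x) := Iff.rfl

theorem holds_imp {φ ψ : BForm} : (imp φ ψ).Holds E a ↔ (φ.Holds E a → ψ.Holds E a) := by
  simp [imp, Holds]

theorem holds_or {φ ψ : BForm} : (or φ ψ).Holds E a ↔ φ.Holds E a ∨ ψ.Holds E a := by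
  simp only [or, Holds]
  tauto

theorem holds_ball {i j : ℕ} {φ : BForm} :
    (ball i j φ).Holds E a ↔ ∀ x, E x (a j) → φ.Holds E (Function.update a i x) := by
  simp [ball, Holds]

/-- The bounds on indices in this and the next lemmas prevent capture by the bound variables. A
variable that only bounds the outermost quantifier, such as `i`, is evaluated before any update and
needs none. -/
theorem holds_sub {i j : ℕ} (hj : j < 99) :
    (sub i j).Holds E a ↔ ext E (a i) ⊆ ext E (a j) := by
  simp only [sub, holds_ball, holds_mem, Function.update_self,
    Function.update_of_ne (show j ≠ 102 by omega)]
  rfl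

theorem holds_isPair {p x y : ℕ} (hp : p < 100) (hx : x < 100) (hy : y < 100) :
    (isPair p x y).Holds E a ↔ IsPair E (a p) (a x) (a y) := by
  simp only [isPair, IsPair, holds_bex, holds_and, holds_ball, holds_or, holds_eq, holds_mem,
    Function.update_self, Function.update_of_ne (show p ≠ 100 by omega),
    Function.update_of_ne (show x ≠ 100 by omega), Function.update_of_ne (show y ≠ 100 by omega),
    Function.update_of_ne (show p ≠ 101 by omega), Function.update_of_ne (show x ≠ 101 by omega),
    Function.update_of_ne (show y ≠ 101 by omega), Function.update_of_ne (show x ≠ 102 by omega),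
    Function.update_of_ne (show y ≠ 102 by omega), ne_eq, Function.update_of_ne,
    Nat.reduceEqDiff, not_false_eq_true]
  constructor
  · rintro ⟨s, hs, t, ht, h, ⟨h1, h2⟩, h3, h4, h5⟩
    exact ⟨s, t, hs, ht, h, fun x => ⟨h2 x, fun e => e ▸ h1⟩,
      fun x => ⟨h5 x, fun e => e.elim (fun e => e ▸ h3) fun e => e ▸ h4⟩⟩
  · rintro ⟨s, t, hs, ht, h, h1, h2⟩
    exact ⟨s, hs, t, ht, h, ⟨(h1 _).2 rfl, fun x => (h1 x).1⟩, (h2 _).2 (.inl rfl),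
      (h2 _).2 (.inr rfl), fun x => (h2 x).1⟩

theorem holds_app {f x y : ℕ} (hx : x < 99) (hy : y < 99) :
    (app f x y).Holds E a ↔ App E (a f) (a x) (a y) := by
  simp only [app, App, holds_bex, holds_isPair (show 99 < 100 by omega) (show x < 100 by omega)
    (show y < 100 by omega), Function.update_self, Function.update_of_ne (show x ≠ 99 by omega),
    Function.update_of_ne (show y ≠ 99 by omega)]

/-- `v_c` is a subtle operator on the internal sets in `v_p`; uses the variables from `90` on. -/
def isSubtle (p c : ℕ) : BForm :=
  .and (ball 90 c (.bex 91 p (.bex 92 p (isPair 90 91 92))))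
  (.and (ball 91 p (.bex 92 p (.and (app c 91 92)
    (ball 93 p (imp (app c 91 93) (.eq 93 92))))))
  (.and (ball 91 p (ball 92 p (imp (app c 91 92) (.and (sub 91 92) (app c 92 92)))))
  (ball 91 p (ball 92 p (ball 93 p (ball 94 p (imp (app c 91 92) (imp (app c 93 94)
    (imp (sub 91 93) (sub 92 94))))))))))

end BForm

/-- Confines arguments and values to given sets. This is how the unbounded quantifiers in `IsSubtle`
become bounded ones. -/
theorem app_mem_of_graph {X : Type z} {E : X → X → Prop} {P Q C x y : X}
    (h : ∀ p, E p C → ∃ x y, E x P ∧ E y Q ∧ IsPair E p x y) (hxy : App E C x y) :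
    E x P ∧ E y Q := by
  obtain ⟨p, hp, hpair⟩ := hxy
  obtain ⟨x', y', hx, hy, hpair'⟩ := h p hp
  obtain ⟨rfl, rfl⟩ := hpair'.unique hpair
  exact ⟨hx, hy⟩

theorem BForm.holds_isSubtle {X : Type z} {E : X → X → Prop} {a : ℕ → X} {p c : ℕ}
    (hp : p < 90) (hc : c < 90) :
    (isSubtle p c).Holds E a ↔ IsSubtle E (a p) (a c) := by
  simp only [isSubtle, holds_and, holds_ball, holds_bex, holds_imp, holds_eq, Nat.reduceLT,
    holds_app, holds_sub, holds_isPair, Function.update_self,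
    Function.update_of_ne (show p ≠ 90 by omega), Function.update_of_ne (show p ≠ 91 by omega),
    Function.update_of_ne (show p ≠ 92 by omega), Function.update_of_ne (show p ≠ 93 by omega),
    Function.update_of_ne (show c ≠ 91 by omega),
    Function.update_of_ne (show c ≠ 92 by omega), Function.update_of_ne (show c ≠ 93 by omega),
    Function.update_of_ne (show c ≠ 94 by omega), ne_eq, Function.update_of_ne,
    Nat.reduceEqDiff, not_false_eq_true]
  constructor
  · rintro ⟨h1, h2, h3, h4⟩
    have hg : ∀ q, E q (a c) → ∃ x y, E x (a p) ∧ E y (a p) ∧ IsPair E q x y := fun q hq => by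
      obtain ⟨x, hx, y, hy, h⟩ := h1 q hq
      exact ⟨x, y, hx, hy, h⟩
    refine ⟨hg, fun x hx => ?_, fun x y h => ?_, fun x y h => ?_, fun x y x' y' h h' hs => ?_⟩
    · obtain ⟨y, hy, h, hu⟩ := h2 x hx
      exact ⟨y, h, fun y' h' => hu y' (app_mem_of_graph hg h').2 h'⟩
    · exact (h3 x (app_mem_of_graph hg h).1 y (app_mem_of_graph hg h).2 h).1
    · exact (h3 x (app_mem_of_graph hg h).1 y (app_mem_of_graph hg h).2 h).2
    · exact h4 x (app_mem_of_graph hg h).1 y (app_mem_of_graph hg h).2 x'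
        (app_mem_of_graph hg h').1 y' (app_mem_of_graph hg h').2 h h' hs
  · intro h
    refine ⟨fun q hq => ?_, fun x hx => ?_, fun x hx y hy hxy => ?_,
      fun x hx y hy x' hx' y' hy' hxy hxy' => h.monotone x y x' y' hxy hxy'⟩
    · obtain ⟨x, y, hx, hy, hxy⟩ := h.graph q hq
      exact ⟨x, hx, y, hy, hxy⟩
    · obtain ⟨y, hy, hu⟩ := h.func x hx
      exact ⟨y, (app_mem_of_graph h.graph hy).2, hy, fun y' _ => hu y'⟩
    · exact ⟨h.extensive x y hxy, h.idempotent x y hxy⟩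

/-! ## Transfer -/

namespace IsEnlargement

variable {H : Type z} {E : H → H → Prop} {star : Super → H}

theorem mem_iff (h : IsEnlargement E star) {x y : Super} : E (star x) (star y) ↔ Mem x y :=
  (h.transfer (.mem 0 1) fun k => if k = 0 then x else y).symm

theorem isPair_iff (h : IsEnlargement E star) {p x y : Super} : IsPair E (star p) (star x) (star y) ↔ IsPair Mem p x y := by
  have := h.transfer (.isPair 0 1 2) fun k => if k = 0 then p else if k = 1 then x else y
  simpa [BForm.holds_isPair] using this.symm

theorem app_iff (h : IsEnlargement E star) {f x y : Super} : App E (star f) (star x) (star y) ↔ App Mem f x y := by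
  have := h.transfer (.app 0 1 2) fun k => if k = 0 then f else if k = 1 then x else y
  simpa [BForm.holds_app] using this.symm

theorem subset_iff (h : IsEnlargement E star) {x y : Super} : ext E (star x) ⊆ ext E (star y) ↔ ext Mem x ⊆ ext Mem y := by
  have := h.transfer (.sub 0 1) fun k => if k = 0 then x else y
  simpa [BForm.holds_sub] using this.symm

theorem isSubtle (h : IsEnlargement E star) {T P : Super} (hT : ∀ c, Mem c T → IsSubtle Mem P c) {c : H}
    (hc : E c (star T)) : IsSubtle E (star P) c := by
  have := h.transfer (.ball 2 0 (.isSubtle 1 2)) fun k => if k = 0 then T else P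
  simp only [BForm.holds_ball, BForm.holds_isSubtle, Nat.reduceLT, Function.update_self, ne_eq,
    Function.update_of_ne, Nat.reduceEqDiff, not_false_eq_true, Function.comp,
    one_ne_zero, if_false, if_true] at this
  exact this.1 hT c hc

end IsEnlargement

/-- On the family `P`, the values of the map `C` are included in those of `C'`. -/
def OpLe {X : Type z} (E : X → X → Prop) (P C C' : X) : Prop :=
  ∀ x, E x P → ∀ y, E y P → ∀ y', E y' P → App E C x y → App E C' x y' → ext E y ⊆ ext E y'

/-- The formula that expresses `OpLe`; uses the variables from `90` on. -/
def BForm.opLe (p c c' : ℕ) : BForm :=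
  ball 90 p (ball 91 p (ball 92 p (imp (app c 90 91) (imp (app c' 90 92) (sub 91 92)))))

theorem BForm.holds_opLe {X : Type z} {E : X → X → Prop} {a : ℕ → X} {p c c' : ℕ}
    (hp : p < 90) (hc : c < 90) (hc' : c' < 90) :
    (opLe p c c').Holds E a ↔ OpLe E (a p) (a c) (a c') := by
  simp only [opLe, OpLe, holds_ball, holds_imp, Nat.reduceLT, holds_app, holds_sub,
    Function.update_self, Function.update_of_ne (show p ≠ 90 by omega),
    Function.update_of_ne (show p ≠ 91 by omega), Function.update_of_ne (show c ≠ 90 by omega),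
    Function.update_of_ne (show c ≠ 91 by omega), Function.update_of_ne (show c ≠ 92 by omega),
    Function.update_of_ne (show c' ≠ 90 by omega), Function.update_of_ne (show c' ≠ 91 by omega),
    Function.update_of_ne (show c' ≠ 92 by omega), ne_eq, Function.update_of_ne,
    Nat.reduceEqDiff, not_false_eq_true]

/-- The relation on `range f` that corresponds to the relation `r` on the index type. -/
noncomputable def indexedRel {ι : Type*} (f : ι → Super) (r : ι → ι → Prop) : Super :=
  ofSet (range fun p : {p : ι × ι // r p.1 p.2} => pair (f p.1.1) (f p.1.2))

theorem app_indexedRel {ι : Type*} {n : ℕ} {f : ι → Super} (hf : ∀ k, (f k).1 ∈ Level n)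
    {r : ι → ι → Prop} {x y : Super} :
    App Mem (indexedRel f r) x y ↔ ∃ j k, r j k ∧ x = f j ∧ y = f k := by
  refine (app_ofSet_range (f := fun p : {p : ι × ι // r p.1 p.2} => f p.1.1)
    (g := fun p => f p.1.2) (fun p => hf p.1.1) (fun p => hf p.1.2)).trans ?_
  constructor
  · rintro ⟨⟨⟨j, k⟩, h⟩, hx, hy⟩
    exact ⟨j, k, h, hx, hy⟩
  · rintro ⟨j, k, h, hx, hy⟩
    exact ⟨⟨⟨j, k⟩, h⟩, hx, hy⟩

theorem within_range {ι : Type*} {n : ℕ} {f : ι → Super} (hf : ∀ k, (f k).1 ∈ Level n) :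
    Within n (range f) := by
  rintro _ ⟨k, rfl⟩
  exact hf k

/-! ### Transfer of order relations, and elements obtained from concurrency. -/

namespace IsEnlargement

variable {H : Type z} {E : H → H → Prop} {star : Super → H}

theorem isSubtle_star (h : IsEnlargement E star) {P C : Super} (hC : IsSubtle Mem P C) :
    IsSubtle E (star P) (star C) := by
  have := h.transfer (.isSubtle 0 1) fun k => if k = 0 then P else C
  simp only [BForm.holds_isSubtle, Nat.reduceLT, Function.comp, one_ne_zero, if_false,
    if_true] at this
  exact this.1 hC

/-- The bound that saturation provides is a mere element of `H`; this places it in `star T`. -/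
theorem graph (h : IsEnlargement E star) {R T : Super}
    (hR : ∀ p, Mem p R → ∃ x y, Mem x T ∧ Mem y T ∧ IsPair Mem p x y) {p : H}
    (hp : E p (star R)) : ∃ x y, E x (star T) ∧ E y (star T) ∧ IsPair E p x y := by
  have := h.transfer (.ball 2 0 (.bex 3 1 (.bex 4 1 (.isPair 2 3 4))))
    fun k => if k = 0 then R else T
  simp only [BForm.holds_ball, BForm.holds_bex, BForm.holds_isPair, Nat.reduceLT,
    Function.update_self, ne_eq, Function.update_of_ne, Nat.reduceEqDiff, not_false_eq_true,
    Function.comp, one_ne_zero, OfNat.one_ne_ofNat, if_false, if_true] at this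
  obtain ⟨x, hx, y, hy, hxy⟩ := this.1 (fun p hp => by
    obtain ⟨x, y, hx, hy, hxy⟩ := hR p hp
    exact ⟨x, hx, y, hy, hxy⟩) p hp
  exact ⟨x, y, hx, hy, hxy⟩

/-- Here `c` is standard but `d` may be nonstandard: `star R`-relatedness to `star c` becomes an
actual inequality. -/
theorem opLe_of_app (h : IsEnlargement E star) {R T P c : Super}
    (hR : ∀ d, Mem d T → App Mem R c d → OpLe Mem P c d) {d : H} (hd : E d (star T))
    (hcd : App E (star R) (star c) d) : OpLe E (star P) (star c) d := by
  have := h.transfer (.ball 4 0 (.imp (.app 1 2 4) (.opLe 3 2 4)))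
    fun k => if k = 0 then T else if k = 1 then R else if k = 2 then c else P
  simp [BForm.holds_ball, BForm.holds_imp, BForm.holds_app, BForm.holds_opLe] at this
  exact this.1 hR d hd hcd

theorem subset_of_app (h : IsEnlargement E star) {R T c : Super}
    (hR : ∀ d, Mem d T → App Mem R c d → ext Mem c ⊆ ext Mem d) {d : H} (hd : E d (star T))
    (hcd : App E (star R) (star c) d) : ext E (star c) ⊆ ext E d := by
  have := h.transfer (.ball 3 0 (.imp (.app 1 2 3) (.sub 2 3)))
    fun k => if k = 0 then T else if k = 1 then R else c
  simp [BForm.holds_ball, BForm.holds_imp, BForm.holds_app, BForm.holds_sub] at this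
  exact this.1 hR d hd hcd

theorem opLe_star (h : IsEnlargement E star) {T P S : Super}
    (hT : ∀ d, Mem d T → OpLe Mem P d S) {d : H} (hd : E d (star T)) :
    OpLe E (star P) d (star S) := by
  have := h.transfer (.ball 3 0 (.opLe 1 3 2))
    fun k => if k = 0 then T else if k = 1 then P else S
  simp [BForm.holds_ball, BForm.holds_opLe] at this
  exact this.1 hT d hd

theorem subset_star (h : IsEnlargement E star) {T S : Super}
    (hT : ∀ d, Mem d T → ext Mem d ⊆ ext Mem S) {d : H} (hd : E d (star T)) :
    ext E d ⊆ ext E (star S) := by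
  have := h.transfer (.ball 2 0 (.sub 2 1)) fun k => if k = 0 then T else S
  simp [BForm.holds_ball, BForm.holds_sub] at this
  exact this.1 hT d hd

/-- A relation that is concurrent on an indexed set is satisfied by one element of its extension
at all standard elements of the set. -/
theorem exists_bound (h : IsEnlargement E star) {ι : Type*} [Nonempty ι] {n : ℕ} {f : ι → Super}
    (hf : ∀ k, (f k).1 ∈ Level n) {r : ι → ι → Prop}
    (hr : ∀ s : Set ι, s.Finite → ∃ k, ∀ j ∈ s, r j k) :
    ∃ b, E b (star (ofSet (range f))) ∧
      ∀ j, App E (star (indexedRel f r)) (star (f j)) b := by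
  have hb : ∃ b : H, ∀ x : Super, (∃ y, App Mem (indexedRel f r) x y) →
      App E (star (indexedRel f r)) (star x) b := by
    refine h.saturated _ fun F hF hdom => ?_
    have hj : ∀ x : F, ∃ j, x.1 = f j := fun x => by
      obtain ⟨y, hy⟩ := hdom x.1 x.2
      obtain ⟨j, -, -, hj, -⟩ := (app_indexedRel hf).1 hy
      exact ⟨j, hj⟩
    choose j hj using hj
    have := hF.to_subtype
    obtain ⟨k, hk⟩ := hr (range j) (finite_range j)
    exact ⟨f k, fun x hx => (app_indexedRel hf).2 ⟨j ⟨x, hx⟩, k, hk _ ⟨_, rfl⟩, hj ⟨x, hx⟩, rfl⟩⟩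
  obtain ⟨b, hb⟩ := hb
  -- Concurrency for singletons puts every `f j` into the domain of the relation.
  have hb' : ∀ j, App E (star (indexedRel f r)) (star (f j)) b := fun j => by
    obtain ⟨k, hk⟩ := hr {j} (finite_singleton j)
    exact hb _ ⟨f k, (app_indexedRel hf).2 ⟨j, k, hk j rfl, rfl, rfl⟩⟩
  refine ⟨b, ?_, hb'⟩
  have hpairs : Within (n + 2)
      (range fun p : {p : ι × ι // r p.1 p.2} => pair (f p.1.1) (f p.1.2)) :=
    within_range fun p => pair_level (hf _) (hf _)
  refine (app_mem_of_graph (fun p hp => h.graph (T := ofSet (range f)) (fun q hq => ?_) hp)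
    (hb' (Classical.arbitrary ι))).2
  obtain ⟨p, rfl⟩ := hpairs.mem_ofSet.1 hq
  exact ⟨_, _, (within_range hf).mem_ofSet.2 ⟨_, rfl⟩, (within_range hf).mem_ofSet.2 ⟨_, rfl⟩,
    isPair_pair _ _⟩

/-- On an infinite set the relation `≠` is concurrent. -/
theorem exists_nonstandard (h : IsEnlargement E star) {ι : Type*} [Infinite ι] {n : ℕ}
    {f : ι → Super} (hf : ∀ k, (f k).1 ∈ Level n) (hinj : Function.Injective f) :
    ∃ b, E b (star (ofSet (range f))) ∧ ∀ x, b ≠ star x := by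
  obtain ⟨b, hb, hbj⟩ := h.exists_bound hf (r := fun j k => j ≠ k) fun s hs => by
    obtain ⟨k, hk⟩ := hs.exists_notMem
    exact ⟨k, fun j hj e => hk (e ▸ hj)⟩
  refine ⟨b, hb, ?_⟩
  rintro x rfl
  obtain ⟨j, rfl⟩ := (within_range hf).mem_ofSet.1 (h.mem_iff.1 hb)
  obtain ⟨k, l, hkl, hk, hl⟩ := (app_indexedRel hf).1 (h.app_iff.1 (hbj j))
  exact hkl ((hinj hk).symm.trans (hinj hl))

end IsEnlargement

/-! ## Operators in the superstructure -/

section Bold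

variable {L : FirstOrder.Language.{u, v}} {code : Fml L → Super} {l : ℕ}

theorem within_image_code (hl : ∀ φ, (code φ).1 ∈ Level l) (X : Set (Fml L)) :
    Within l (code '' X) := by
  rintro _ ⟨φ, -, rfl⟩
  exact hl φ

theorem mem_boldSet (hl : ∀ φ, (code φ).1 ∈ Level l) {X : Set (Fml L)} {x : Super} :
    Mem x (boldSet code X) ↔ ∃ φ ∈ X, code φ = x :=
  (within_image_code hl X).mem_ofSet

theorem code_mem_boldSet (hl : ∀ φ, (code φ).1 ∈ Level l) (hc : Function.Injective code)
    {X : Set (Fml L)} {φ : Fml L} : Mem (code φ) (boldSet code X) ↔ φ ∈ X := by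
  rw [mem_boldSet hl]
  exact ⟨fun ⟨ψ, hψ, e⟩ => hc e ▸ hψ, fun h => ⟨φ, h, rfl⟩⟩

theorem ext_boldSet_subset (hl : ∀ φ, (code φ).1 ∈ Level l) (hc : Function.Injective code)
    {X Y : Set (Fml L)} : ext Mem (boldSet code X) ⊆ ext Mem (boldSet code Y) ↔ X ⊆ Y := by
  constructor
  · exact fun h φ hφ => (code_mem_boldSet hl hc).1 (h ((code_mem_boldSet hl hc).2 hφ))
  · rintro h x hx
    obtain ⟨φ, hφ, rfl⟩ := (mem_boldSet hl).1 hx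
    exact (code_mem_boldSet hl hc).2 (h hφ)

theorem boldSet_injective (hl : ∀ φ, (code φ).1 ∈ Level l) (hc : Function.Injective code) :
    Function.Injective (boldSet code) := fun X Y h =>
  Subset.antisymm ((ext_boldSet_subset hl hc).1 (by rw [h]))
    ((ext_boldSet_subset hl hc).1 (by rw [h]))

theorem boldSet_level (hl : ∀ φ, (code φ).1 ∈ Level l) (X : Set (Fml L)) :
    (boldSet code X).1 ∈ Level (l + 1) :=
  (within_image_code hl X).ofSet_level

theorem mem_boldPower (hl : ∀ φ, (code φ).1 ∈ Level l) {x : Super} :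
    Mem x (boldPower code) ↔ ∃ X, boldSet code X = x :=
  (within_range (boldSet_level hl)).mem_ofSet

/-- The indexed form that `exists_bound` requires. -/
theorem boldFin_eq (X : Set (Fml L)) :
    boldFin code X = ofSet (range fun F : {F : Set (Fml L) // F.Finite ∧ F ⊆ X} =>
      boldSet code F.1) := by
  rw [boldFin, image_eq_range]
  rfl

theorem mem_boldFin (hl : ∀ φ, (code φ).1 ∈ Level l) {X : Set (Fml L)} {x : Super} :
    Mem x (boldFin code X) ↔ ∃ F, (F.Finite ∧ F ⊆ X) ∧ boldSet code F = x := by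
  rw [boldFin_eq]
  refine (within_range fun F : {F : Set (Fml L) // F.Finite ∧ F ⊆ X} =>
    boldSet_level hl F.1).mem_ofSet.trans ?_
  simp

theorem within_boldOp (hl : ∀ φ, (code φ).1 ∈ Level l) (C : ClosureOperator (Set (Fml L))) :
    Within (l + 3) (range fun X => pair (boldSet code X) (boldSet code (C X))) :=
  within_range fun _ => pair_level (boldSet_level hl _) (boldSet_level hl _)

theorem boldOp_level (hl : ∀ φ, (code φ).1 ∈ Level l) (C : ClosureOperator (Set (Fml L))) :
    (boldOp code C).1 ∈ Level (l + 4) :=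
  (within_boldOp hl C).ofSet_level

theorem app_boldOp (hl : ∀ φ, (code φ).1 ∈ Level l) {C : ClosureOperator (Set (Fml L))}
    {x y : Super} :
    App Mem (boldOp code C) x y ↔ ∃ X, x = boldSet code X ∧ y = boldSet code (C X) :=
  app_ofSet_range (boldSet_level hl) fun X => boldSet_level hl (C X)

theorem opLe_boldOp (hl : ∀ φ, (code φ).1 ∈ Level l) (hc : Function.Injective code)
    {C C' : ClosureOperator (Set (Fml L))} (h : ⇑C ≤ ⇑C') :
    OpLe Mem (boldPower code) (boldOp code C) (boldOp code C') := by
  intro x _ y _ y' _ hxy hxy'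
  obtain ⟨X, rfl, rfl⟩ := (app_boldOp hl).1 hxy
  obtain ⟨X', hX, rfl⟩ := (app_boldOp hl).1 hxy'
  rw [← boldSet_injective hl hc hX]
  exact (ext_boldSet_subset hl hc).2 (h X)

theorem boldOp_injective (hl : ∀ φ, (code φ).1 ∈ Level l) (hc : Function.Injective code) :
    Function.Injective (boldOp code) := by
  intro C C' h
  refine ClosureOperator.ext _ _ fun X => ?_
  have := (app_boldOp hl (C := C)).2 ⟨X, rfl, rfl⟩
  rw [h] at this
  obtain ⟨X', hX, hCX⟩ := (app_boldOp hl).1 this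
  rw [boldSet_injective hl hc hCX, boldSet_injective hl hc hX]

theorem isSubtle_boldOp (hl : ∀ φ, (code φ).1 ∈ Level l) (hc : Function.Injective code)
    (C : ClosureOperator (Set (Fml L))) : IsSubtle Mem (boldPower code) (boldOp code C) where
  graph p hp := by
    obtain ⟨X, rfl⟩ := (within_boldOp hl C).mem_ofSet.1 hp
    exact ⟨_, _, (mem_boldPower hl).2 ⟨_, rfl⟩, (mem_boldPower hl).2 ⟨_, rfl⟩, isPair_pair _ _⟩
  func x hx := by
    obtain ⟨X, rfl⟩ := (mem_boldPower hl).1 hx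
    refine ⟨_, (app_boldOp hl).2 ⟨X, rfl, rfl⟩, fun y hy => ?_⟩
    obtain ⟨X', hX, rfl⟩ := (app_boldOp hl).1 hy
    rw [boldSet_injective hl hc hX]
  extensive x y hxy := by
    obtain ⟨X, rfl, rfl⟩ := (app_boldOp hl).1 hxy
    exact (ext_boldSet_subset hl hc).2 (C.le_closure X)
  idempotent x y hxy := by
    obtain ⟨X, rfl, rfl⟩ := (app_boldOp hl).1 hxy
    exact (app_boldOp hl).2 ⟨C X, rfl, by rw [C.idempotent]⟩
  monotone x y x' y' hxy hxy' hs := by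
    obtain ⟨X, rfl, rfl⟩ := (app_boldOp hl).1 hxy
    obtain ⟨X', rfl, rfl⟩ := (app_boldOp hl).1 hxy'
    exact (ext_boldSet_subset hl hc).2 (C.monotone ((ext_boldSet_subset hl hc).1 hs))

theorem mem_boldChain (hl : ∀ φ, (code φ).1 ∈ Level l) {C : ℕ → ClosureOperator (Set (Fml L))}
    {x : Super} : Mem x (boldChain code C) ↔ ∃ n, boldOp code (C n) = x :=
  (within_range fun n => boldOp_level hl (C n)).mem_ofSet

end Bold

/-! ### The ideal operator and the ideal finite set. -/

namespace IsEnlargement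

variable {H : Type z} {E : H → H → Prop} {star : Super → H}
  {L : FirstOrder.Language.{u, v}} {code : Fml L → Super} {l : ℕ}

theorem isSubtle_of_mem_boldChain (h : IsEnlargement E star)
    (hl : ∀ φ, (code φ).1 ∈ Level l) (hc : Function.Injective code)
    {C : ℕ → ClosureOperator (Set (Fml L))} {c : H} (hcT : E c (star (boldChain code C))) :
    IsSubtle E (star (boldPower code)) c :=
  h.isSubtle (fun d hd => by
    obtain ⟨n, rfl⟩ := (mem_boldChain hl).1 hd
    exact isSubtle_boldOp hl hc _) hcT

/-- A subtle operator whose graph consists of standard elements only does not exist, since there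
are nonstandard internal sets of formulas. -/
theorem ext_ne_image_star (h : IsEnlargement E star) [Infinite (Fml L)]
    (hl : ∀ φ, (code φ).1 ∈ Level l) (hc : Function.Injective code) {c : H}
    (hs : IsSubtle E (star (boldPower code)) c) (D : Super) : ext E c ≠ star '' ext Mem D := by
  intro hD
  obtain ⟨b, hb, hne⟩ := h.exists_nonstandard (boldSet_level hl) (boldSet_injective hl hc)
  obtain ⟨y, ⟨p, hp, hpair⟩, -⟩ := hs.func b hb
  obtain ⟨d, -, rfl⟩ : p ∈ star '' ext Mem D := hD ▸ hp
  -- The pair in `c` with first coordinate `b` is `star d`. Transfer downwards makes `d` a pair, so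
  -- `b` would be standard.
  have hstd : ∃ x y, IsPair Mem d x y := by
    have := h.transfer (.bex 2 1 (.bex 3 1 (.isPair 0 2 3)))
      fun k => if k = 0 then d else boldPower code
    simp [BForm.holds_bex, BForm.holds_isPair] at this
    obtain ⟨x, -, y, -, hxy⟩ := this.2 ⟨b, hb, y,
      (app_mem_of_graph hs.graph ⟨_, hp, hpair⟩).2, hpair⟩
    exact ⟨x, y, hxy⟩
  obtain ⟨x, y', hxy⟩ := hstd
  exact hne x (hpair.unique (h.isPair_iff.2 hxy)).1

/-- There is an operator in the extension of the chain that lies above all members of the chain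
and is purely subtle. -/
theorem exists_isPurelySubtle (h : IsEnlargement E star) [Infinite (Fml L)]
    (hl : ∀ φ, (code φ).1 ∈ Level l) (hc : Function.Injective code)
    {C : ℕ → ClosureOperator (Set (Fml L))} (chain : ∀ m n, ⇑(C m) ≤ ⇑(C n) ∨ ⇑(C n) ≤ ⇑(C m))
    (strict : ∀ m, ∃ n, ⇑(C m) < ⇑(C n)) :
    ∃ c, IsPurelySubtle E star (star (boldPower code)) c ∧ E c (star (boldChain code C)) ∧
      ∀ n, OpLe E (star (boldPower code)) (star (boldOp code (C n))) c := by
  have hf : ∀ n, (boldOp code (C n)).1 ∈ Level (l + 4) := fun n => boldOp_level hl _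
  obtain ⟨c, hcT, hcR⟩ := h.exists_bound hf (r := fun m n => ⇑(C m) ≤ ⇑(C n)) fun s hs => by
    -- In a chain, finitely many members have an upper bound among the members.
    induction s, hs using Set.Finite.induction_on with
    | empty => exact ⟨0, fun _ h => h.elim⟩
    | @insert m s _ _ ih =>
      obtain ⟨k, hk⟩ := ih
      rcases chain m k with hmk | hkm
      · exact ⟨k, forall_mem_insert.2 ⟨hmk, hk⟩⟩
      · exact ⟨m, forall_mem_insert.2 ⟨le_rfl, fun j hj => (hk j hj).trans hkm⟩⟩
  have hs := h.isSubtle_of_mem_boldChain hl hc hcT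
  refine ⟨c, ⟨hs, ?_⟩, hcT, fun n => h.opLe_of_app (fun d _ hnd => ?_) hcT (hcR n)⟩
  · rintro ⟨D, rfl | hD⟩
    -- A standard `c` is some `*Cₙ`; being above the image of a strictly larger `Cₘ` as well, it
    -- gives `Cₘ ≤ Cₙ`.
    · obtain ⟨n, rfl⟩ := (mem_boldChain hl).1 (h.mem_iff.1 hcT)
      obtain ⟨m, hm⟩ := strict n
      obtain ⟨j, k, hjk, hj, hk⟩ := (app_indexedRel hf).1 (h.app_iff.1 (hcR m))
      rw [← boldOp_injective hl hc hj, ← boldOp_injective hl hc hk] at hjk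
      exact hm.not_ge hjk
    · exact h.ext_ne_image_star hl hc hs D hD
  · obtain ⟨j, k, hjk, hj, rfl⟩ := (app_indexedRel hf).1 hnd
    rw [hj]
    exact opLe_boldOp hl hc hjk

/-- There is a `*`-finite internal subset of `*A` that includes all standard finite subsets
of `A`. -/
theorem exists_boldFin (h : IsEnlargement E star)
    (hl : ∀ φ, (code φ).1 ∈ Level l) (hc : Function.Injective code) (A : Set (Fml L)) :
    ∃ F, E F (star (boldFin code A)) ∧
      ∀ G ⊆ A, G.Finite → ext E (star (boldSet code G)) ⊆ ext E F := by
  have : Nonempty {F : Set (Fml L) // F.Finite ∧ F ⊆ A} := ⟨∅, finite_empty, empty_subset _⟩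
  have hf : ∀ F : {F : Set (Fml L) // F.Finite ∧ F ⊆ A}, (boldSet code F.1).1 ∈ Level (l + 1) :=
    fun F => boldSet_level hl _
  obtain ⟨F, hF, hFR⟩ := h.exists_bound hf (r := fun F G => F.1 ⊆ G.1) fun s hs =>
    ⟨⟨⋃ F ∈ s, F.1, hs.biUnion fun F _ => F.2.1, iUnion₂_subset fun F _ => F.2.2⟩,
      fun F hF => subset_biUnion_of_mem (u := fun F => F.1) hF⟩
  rw [← boldFin_eq] at hF
  refine ⟨F, hF, fun G hGA hG => h.subset_of_app (fun d _ hd => ?_) hF (hFR ⟨G, hG, hGA⟩)⟩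
  obtain ⟨j, k, hjk, hj, rfl⟩ := (app_indexedRel hf).1 hd
  rw [hj]
  exact (ext_boldSet_subset hl hc).2 hjk

end IsEnlargement

end Nonstd

open Nonstd in
theorem theorem4p5 {L : FirstOrder.Language.{u, v}} (hL : ∃ k, Nonempty (L.Relations k))
    {𝒜 : Type w} [Finite 𝒜] (spell : Nonstd.Fml L → Nonstd.Word 𝒜)
    (hspell : Function.Injective spell) (i : Nonstd.Word 𝒜 → ℕ) (hi : Function.Injective i)
    (code : Nonstd.Fml L → Nonstd.Super) (hcode : ∀ φ, code φ = Nonstd.readable i (spell φ))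
    {H : Type z} (E : H → H → Prop) (star : Nonstd.Super → H)
    (hstar : Nonstd.IsEnlargement E star) :
    (∃ R : ℕ → Set (Nonstd.Fml L × Nonstd.Fml L),
      Nonstd.IsApproximation fun n => Nonstd.restrictedOp (R n)) ∧
    ∀ C : ℕ → ClosureOperator (Set (Nonstd.Fml L)), Nonstd.IsApproximation C →
    ∀ A : Set (Nonstd.Fml L), ∃ C₁ F₁ : H,
      Nonstd.IsPurelySubtle E star (star (Nonstd.boldPower code)) C₁ ∧
      E C₁ (star (Nonstd.boldChain code C)) ∧
      E F₁ (star (Nonstd.boldFin code A)) ∧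
      (∀ B ⊆ A, ∀ n, star ∘ code '' (C n B) ⊆ Nonstd.val E C₁ F₁) ∧
      (∀ B ⊆ A, star ∘ code '' (Nonstd.predicateOp L B) ⊆ Nonstd.val E C₁ F₁) ∧
      Nonstd.val E C₁ F₁ ⊆
        Nonstd.val E (star (Nonstd.boldOp code (Nonstd.predicateOp L))) F₁ ∧
      Nonstd.val E (star (Nonstd.boldOp code (Nonstd.predicateOp L))) F₁ ⊆
        Nonstd.ext E (star (Nonstd.boldSet code (Nonstd.predicateOp L A))) ∧
      Nonstd.val E (star (Nonstd.boldOp code (Nonstd.predicateOp L))) F₁ ∩ range (star ∘ code) =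
        star ∘ code '' (Nonstd.predicateOp L A) ∧
      Nonstd.val E C₁ F₁ ∩ range (star ∘ code) = star ∘ code '' (Nonstd.predicateOp L A) := by
  refine ⟨exists_isApproximation_restrictedOp hL, fun C hC A => ?_⟩
  have hl : ∀ φ, (code φ).1 ∈ Level 4 := fun φ => hcode φ ▸ readable_level i _
  have hc : Function.Injective code := fun φ ψ h =>
    hspell (readable_injective hi (by rw [← hcode, ← hcode, h]))
  have := infinite_fml hL
  obtain ⟨C₁, hpure, hT, hle⟩ := hstar.exists_isPurelySubtle hl hc hC.chain hC.strict
  obtain ⟨F₁, hF, hFG⟩ := hstar.exists_boldFin hl hc A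
  have hsub := hpure.1
  have hS := hstar.isSubtle_star (isSubtle_boldOp hl hc (predicateOp L))
  have hFP : E F₁ (star (boldPower code)) := hstar.subset_iff.2 (fun x hx => by
    obtain ⟨F, -, rfl⟩ := (mem_boldFin hl).1 hx
    exact (mem_boldPower hl).2 ⟨F, rfl⟩) hF
  have hset : ∀ X, E (star (boldSet code X)) (star (boldPower code)) := fun X =>
    hstar.mem_iff.2 ((mem_boldPower hl).2 ⟨X, rfl⟩)
  have happ : ∀ (D : ClosureOperator (Set (Fml L))) X,
      App E (star (boldOp code D)) (star (boldSet code X)) (star (boldSet code (D X))) :=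
    fun D X => hstar.app_iff.2 ((app_boldOp hl).2 ⟨X, rfl, rfl⟩)
  have hCn : ∀ B ⊆ A, ∀ n, star ∘ code '' (C n B) ⊆ val E C₁ F₁ := by
    rintro B hB n _ ⟨φ, hφ, rfl⟩
    rw [hC.finitary] at hφ
    obtain ⟨G, ⟨hG, hGB⟩, hφ⟩ := mem_iUnion₂.1 hφ
    obtain ⟨y, hy, -⟩ := hsub.func F₁ hFP
    obtain ⟨y', hy', -⟩ := hsub.func _ (hset G)
    refine ⟨y, hy, ?_⟩
    exact hsub.monotone _ _ _ _ hy' hy (hFG G (hGB.trans hB) hG)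
      (hle n _ (hset G) _ (hset _) _ (app_mem_of_graph hsub.graph hy').2 (happ (C n) G) hy'
        (hstar.mem_iff.2 ((code_mem_boldSet hl hc).2 hφ)))
  have hii : ∀ B ⊆ A, star ∘ code '' (predicateOp L B) ⊆ val E C₁ F₁ := by
    intro B hB
    rw [hC.union, image_iUnion]
    exact iUnion_subset (hCn B hB)
  have hii' : val E C₁ F₁ ⊆ val E (star (boldOp code (predicateOp L))) F₁ := by
    rintro r ⟨y, hy, hr⟩
    obtain ⟨z, hz, -⟩ := hS.func F₁ hFP
    refine ⟨z, hz, hstar.opLe_star (fun d hd => ?_) hT F₁ hFP y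
      (app_mem_of_graph hsub.graph hy).2 z (app_mem_of_graph hS.graph hz).2 hy hz hr⟩
    obtain ⟨n, rfl⟩ := (mem_boldChain hl).1 hd
    refine opLe_boldOp hl hc fun X => ?_
    rw [hC.union]
    exact subset_iUnion (fun n => C n X) n
  have hii'' : val E (star (boldOp code (predicateOp L))) F₁ ⊆
      ext E (star (boldSet code (predicateOp L A))) := by
    rintro r ⟨y, hy, hr⟩
    refine hS.monotone _ _ _ _ hy (happ _ A) (hstar.subset_star (fun d hd => ?_) hF) hr
    obtain ⟨F, hFA, rfl⟩ := (mem_boldFin hl).1 hd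
    exact (ext_boldSet_subset hl hc).2 hFA.2
  have hstd : ext E (star (boldSet code (predicateOp L A))) ∩ range (star ∘ code) ⊆
      star ∘ code '' (predicateOp L A) := by
    rintro _ ⟨hr, φ, rfl⟩
    exact ⟨φ, (code_mem_boldSet hl hc).1 (hstar.mem_iff.1 hr), rfl⟩
  have hrange := image_subset_range (star ∘ code) (predicateOp L A)
  exact ⟨C₁, F₁, hpure, hT, hF, hCn, hii, hii', hii'',
    Subset.antisymm ((inter_subset_inter_left _ hii'').trans hstd)
      (subset_inter ((hii A subset_rfl).trans hii') hrange),
    Subset.antisymm ((inter_subset_inter_left _ (hii'.trans hii'')).trans hstd)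
      (subset_inter (hii A subset_rfl) hrange)⟩
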